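/- Let $0<\underline\theta<\bar\theta$, $\Theta=[\underline\theta,\bar\theta]$, $p>0$, $\bar u>0$, $\alpha_0\in\mathbb R$, $\mathbb U=[0,\bar u]$. Let $\pi,g:(0,\infty)\to\mathbb R$ be non-decreasing and strictly concave, $\pi$ twice continuously differentiable with $\pi''<0$, $g$ differentiable. Let $f$ be a probability density on $\Theta$, positive on $(\underline\theta,\bar\theta)$, with distribution function $F$, whose hazard rate $h=f/(1-F)$ is increasing (non-decreasing) on $[\underline\theta,\bar\theta)$. Let $\Gamma$ be the inverse function of $\pi':(0,\infty)\to\mathbb R$, $\chi(\theta,a)=\Gamma\big(\frac{p-a}{\theta}\big)$, which is defined for $a\in D_\theta:=\{a:\frac{p-a}{\theta}\in\pi'((0,\infty))\}$, $K(x,\theta,a)=ax+\theta\pi(x)-px$, $K_\theta(\theta,a)=\frac{d}{d\theta}K(\chi(\theta,a),\theta,a)$ (with $a$ fixed), and $$V_{sp}(\theta,a)=\Big[g(\chi(\theta,a))-K_\theta(\theta,a)\frac1{h(\theta)}+\theta\pi(\chi(\theta,a))-p\,\chi(\theta,a)\Big]f(\theta).$$ A state function is an absolutely continuous $\alpha:\Theta\to\mathbb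 R$ with $\alpha(\underline\theta)=\alpha_0$ and $\alpha(\theta)\in D_\theta$ for all $\theta\in\Theta$. Consider the optimal control problem $$\max\int_{\underline\theta}^{\bar\theta}V_{sp}(\theta,\alpha(\theta))\,d\theta\quad\text{subject to}\quad \dot\alpha=u,\quad u\in\mathbb U\ \text{ a.e. on }\Theta,$$ over state functions $\alpha$ and controls $u$, with Hamiltonian $H(\theta,\alpha,u,\lambda)=V_{sp}(\theta,\alpha)+\lambda u$. Suppose that $V_{sp}$ is concave in the reward factor, i.e. for every $\theta\in\Theta$ the function $V_{sp}(\theta,\cdot)$ is concave on the set $D_\theta\cap[\alpha_0,\alpha_0+\bar u(\theta-\underline\theta)]$ of attainable values. Then, for a function $u$ and a state function $\alpha$, the pair $(u,\alpha)$ is a solution of the problem if and only if there is an absolutely continuous $\lambda:\Theta\to\mathbb R$ such that, for almost every $\theta\in\Theta$, $$\dot\alpha(\theta)=\frac{\partial H}{\partial\lambda}(\theta,\alpha(\theta),u(\theta),\lambda(\theta)),\qquad \dot\lambda(\theta)=\frac{\partial H}{\partial\alpha}(\theta,\alpha(\theta),u(\theta),\lambda(\theta)),\qquad u(\theta)\in\arg\min_{v\in\mathbb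 U}H(\theta,\alpha(\theta),v,\lambda(\theta)),$$ and $\lambda(\bar\theta)=0$. The necessity of these conditions holds also without the concavity of $V_{sp}$. -/

import Mathlib

open Set MeasureTheory

noncomputable section

/-- The data of the task-allocation problem: the type interval `[lo, hi]`, the density `dens` of the
type, the agent's revenue function `rev` (written `π`), the publisher's revenue function `gain`
(written `g`), the marginal cost `p`, the initial reward factor `a₀` and the bound `ubar` on the
slope of the reward factor. -/
structure TaskModel where
  lo : ℝ
  hi : ℝ
  dens : ℝ → ℝ
  rev : ℝ → ℝ
  gain : ℝ → ℝ
  p : ℝ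
  a₀ : ℝ
  ubar : ℝ

namespace TaskModel

variable (M : TaskModel)

/-- The type interval `Θ`. -/
def types : Set ℝ := Icc M.lo M.hi

/-- The control set `𝕌 = [0, ubar]`. -/
def controls : Set ℝ := Icc 0 M.ubar

/-- The cumulative distribution function `F` of the type, on `Θ`. -/
def typeCDF (θ : ℝ) : ℝ := ∫ t in M.lo..θ, M.dens t

/-- The hazard rate `h = f / (1 - F)`. -/
def hazard (θ : ℝ) : ℝ := M.dens θ / (1 - M.typeCDF θ)

/-- `Γ`, the inverse function of `π' : (0, ∞) → ℝ`; meaningful on the range of `π'`. -/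
def Gam : ℝ → ℝ := Function.invFunOn (deriv M.rev) (Ioi 0)

/-- The reward factors to which type `θ` has a (positive) best response, i.e. those `a` for which
`(p - a) / θ` lies in the range of `π'`, the domain of `Γ`. -/
def responseDomain (θ : ℝ) : Set ℝ := {a | (M.p - a) / θ ∈ deriv M.rev '' Ioi 0}

/-- The best response `χ(θ, a) = Γ((p - a) / θ)` of type `θ` to the reward factor `a`. -/
def chi (θ a : ℝ) : ℝ := M.Gam ((M.p - a) / θ)

/-- `K(x, θ, a) = a x + θ π(x) - p x`. -/
def K (x θ a : ℝ) : ℝ := a * x + θ * M.rev x - M.p * x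

/-- `K_θ`: the derivative of `K(χ(θ, a), θ, a)` with respect to the actual type `θ`, for a fixed
reward factor `a`. -/
def Ktheta (θ a : ℝ) : ℝ := deriv (fun t => M.K (M.chi t a) t a) θ

/-- The integrand `V_sp` at the type `θ` and the reward factor `a`. At `θ = hi` the hazard rate is
infinite in the usual convention; there `1 / hazard = 0`, as it should be. -/
def Vsp (θ a : ℝ) : ℝ :=
  (M.gain (M.chi θ a) - M.Ktheta θ a * (1 / M.hazard θ)
    + θ * M.rev (M.chi θ a) - M.p * M.chi θ a) * M.dens θ

/-- The Hamiltonian `H(α, u, λ) = V_sp(α) + λ u` (at the type `θ`). -/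
def Ham (θ a u l : ℝ) : ℝ := M.Vsp θ a + l * u

/-- The objective `∫ V_sp`. -/
def objective (α : ℝ → ℝ) : ℝ := ∫ θ in M.lo..M.hi, M.Vsp θ (α θ)

/-- State functions: absolutely continuous, starting at `a₀`, and such that the best response
`χ(θ, α(θ))` exists for every type. -/
structure IsState (α : ℝ → ℝ) : Prop where
  abs_cont : AbsolutelyContinuousOnInterval α M.lo M.hi
  initial : α M.lo = M.a₀
  response : ∀ θ ∈ M.types, α θ ∈ M.responseDomain θ

/-- Feasible pairs of the optimal control problem: `α` is a state function, `α' = u` and `u ∈ 𝕌`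
almost everywhere. (Such a `u` is automatically a.e.-measurable on `Θ`.) -/
structure IsFeasible (u α : ℝ → ℝ) : Prop where
  state : M.IsState α
  dynamics : ∀ᵐ θ ∂volume.restrict M.types, HasDerivAt α (u θ) θ
  control : ∀ᵐ θ ∂volume.restrict M.types, u θ ∈ M.controls

/-- `(u, α)` solves the optimal control problem: it is feasible and maximizes `∫ V_sp`. -/
def IsOptimal (u α : ℝ → ℝ) : Prop :=
  M.IsFeasible u α ∧ ∀ v β : ℝ → ℝ, M.IsFeasible v β → M.objective β ≤ M.objective α

/-- The conditions of the minimum principle for `(u, α)` with costate `lam`. -/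
structure MinimumPrinciple (u α lam : ℝ → ℝ) : Prop where
  costate_abs_cont : AbsolutelyContinuousOnInterval lam M.lo M.hi
  state_eq : ∀ᵐ θ ∂volume.restrict M.types,
    HasDerivAt α (deriv (fun l => M.Ham θ (α θ) (u θ) l) (lam θ)) θ
  costate_eq : ∀ᵐ θ ∂volume.restrict M.types,
    HasDerivAt lam (deriv (fun a => M.Ham θ a (u θ) (lam θ)) (α θ)) θ
  argmin : ∀ᵐ θ ∂volume.restrict M.types,
    u θ ∈ M.controls ∧ IsMinOn (fun v => M.Ham θ (α θ) v (lam θ)) M.controls (u θ)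
  terminal : lam M.hi = 0

/-- The reward factors that a feasible state can take at the type `θ`. -/
def reachable (θ : ℝ) : Set ℝ :=
  M.responseDomain θ ∩ Icc M.a₀ (M.a₀ + M.ubar * (θ - M.lo))

end TaskModel

end

open Filter Topology

/-! By the envelope theorem `Ktheta` is `π(χ)`. Wherever `f ≠ 0`, `V_sp` is thus `(g(χ) + θ π(χ) - p
χ) f - π(χ) (1 - F)`, which is differentiable in the reward factor with derivative `dVsp`. The
costate is the primitive of `dVsp` along `α` vanishing at `hi`. For a direction `η` with `η lo = 0`,
integration by parts turns the first variation `∫ dVsp η` into `-∫ λ η'`. This `λ` is the negative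
of the usual costate, hence the argmin.

Necessity needs no needle variations: the controls form a convex set, the dynamics are `α' = u`, and
the state constraint is open, so it is inactive for small perturbations. Moving `u` towards an
admissible `v` gives `0 ≤ ∫ λ (v - u)` (`integral_costate_nonneg`); a bang-bang `v` makes this
pointwise (`ae_isMinOn_costate_mul`).

Sufficiency: concavity bounds the gain of a rival `(v, β)` by `∫ dVsp (β - α) = -∫ λ (v - u) ≤ 0`.
-/

noncomputable section

section ConcaveCalculus

/-- The right inverse of an injective function with nonvanishing strict derivative is
differentiable. -/
theorem hasDerivAt_invFunOn {φ φ' : ℝ → ℝ} {s : Set ℝ} (hs : IsOpen s) (hinj : InjOn φ s)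
    (hφ : ∀ x ∈ s, HasStrictDerivAt φ (φ' x) x) (hne : ∀ x ∈ s, φ' x ≠ 0) {x : ℝ} (hx : x ∈ s) :
    HasDerivAt (Function.invFunOn φ s) (φ' x)⁻¹ (φ x) := by
  refine ((hφ x hx).to_local_left_inverse (hne x hx) ?_).hasDerivAt
  filter_upwards [hs.mem_nhds hx] with z hz
  exact hinj.leftInvOn_invFunOn hz

theorem isOpen_image_of_hasStrictDerivAt {φ φ' : ℝ → ℝ} {s : Set ℝ} (hs : IsOpen s)
    (hφ : ∀ x ∈ s, HasStrictDerivAt φ (φ' x) x) (hne : ∀ x ∈ s, φ' x ≠ 0) :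
    IsOpen (φ '' s) := by
  rw [isOpen_iff_mem_nhds]
  rintro _ ⟨x, hx, rfl⟩
  rw [← (hφ x hx).map_nhds_eq (hne x hx)]
  exact image_mem_map (hs.mem_nhds hx)

/-- A function that is concave on a set lies below its tangent lines there. -/
theorem ConcaveOn.sub_le_mul_sub_of_hasDerivAt {s : Set ℝ} {F : ℝ → ℝ} {d a b : ℝ}
    (hF : ConcaveOn ℝ s F) (ha : a ∈ s) (hb : b ∈ s) (hd : HasDerivAt F d a) :
    F b - F a ≤ d * (b - a) := by
  rcases lt_trichotomy a b with h | h | h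
  · have := hF.slope_le_of_hasDerivAt ha hb h hd
    rwa [slope_def_field, div_le_iff₀ (by linarith)] at this
  · simp [h]
  · have := hF.le_slope_of_hasDerivAt hb ha h hd
    rw [slope_def_field, le_div_iff₀ (by linarith)] at this
    linarith

end ConcaveCalculus

/-! ### The best response and the integrand as functions of the reward factor. -/

namespace TaskModel

/-- The standing assumptions on the revenue functions and the density of types. -/
structure Regular (M : TaskModel) : Prop where
  lo_pos : 0 < M.lo
  lo_lt_hi : M.lo < M.hi
  rev_smooth : ContDiffOn ℝ 2 M.rev (Ioi 0)
  rev_deriv2 : ∀ x ∈ Ioi (0 : ℝ), deriv (deriv M.rev) x < 0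
  gain_conc : ConcaveOn ℝ (Ioi 0) M.gain
  gain_diff : DifferentiableOn ℝ M.gain (Ioi 0)
  dens_int : IntervalIntegrable M.dens volume M.lo M.hi
  dens_pos : ∀ θ ∈ Ioo M.lo M.hi, 0 < M.dens θ

/-- The range of the marginal revenue `π'`, which is the domain of `Γ`. -/
def marginals (M : TaskModel) : Set ℝ := deriv M.rev '' Ioi 0

/-- The derivative of `V_sp` in the reward factor. -/
def dVsp (M : TaskModel) (θ a : ℝ) : ℝ :=
  ((deriv M.gain (M.chi θ a) - a) * M.dens θ - (M.p - a) / θ * (1 - M.typeCDF θ)) *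
    (-(deriv (deriv M.rev) (M.chi θ a))⁻¹ / θ)

theorem Gam_pos {M : TaskModel} {y : ℝ} (hy : y ∈ M.marginals) : M.Gam y ∈ Ioi (0 : ℝ) :=
  Function.invFunOn_mem hy

theorem deriv_rev_Gam {M : TaskModel} {y : ℝ} (hy : y ∈ M.marginals) : deriv M.rev (M.Gam y) = y :=
  Function.invFunOn_eq hy

namespace Regular

variable {M : TaskModel} (hM : M.Regular)
include hM

theorem contDiffOn_deriv_rev : ContDiffOn ℝ 1 (deriv M.rev) (Ioi 0) :=
  hM.rev_smooth.deriv_of_isOpen isOpen_Ioi (by norm_num)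

theorem hasStrictDerivAt_deriv_rev {x : ℝ} (hx : x ∈ Ioi (0 : ℝ)) :
    HasStrictDerivAt (deriv M.rev) (deriv (deriv M.rev) x) x :=
  (hM.contDiffOn_deriv_rev.contDiffAt (isOpen_Ioi.mem_nhds hx)).hasStrictDerivAt (by norm_num)

theorem continuousOn_deriv2_rev : ContinuousOn (deriv (deriv M.rev)) (Ioi 0) :=
  hM.contDiffOn_deriv_rev.continuousOn_deriv_of_isOpen isOpen_Ioi (by norm_num)

theorem hasDerivAt_rev {x : ℝ} (hx : x ∈ Ioi (0 : ℝ)) : HasDerivAt M.rev (deriv M.rev x) x :=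
  ((hM.rev_smooth.contDiffAt (isOpen_Ioi.mem_nhds hx)).differentiableAt (by norm_num)).hasDerivAt

theorem hasDerivAt_gain {x : ℝ} (hx : x ∈ Ioi (0 : ℝ)) : HasDerivAt M.gain (deriv M.gain x) x :=
  (hM.gain_diff.differentiableAt (isOpen_Ioi.mem_nhds hx)).hasDerivAt

theorem antitoneOn_deriv_gain : AntitoneOn (deriv M.gain) (Ioi 0) :=
  hM.gain_conc.antitoneOn_deriv fun _ hx => (hM.hasDerivAt_gain hx).differentiableAt

theorem injOn_deriv_rev : InjOn (deriv M.rev) (Ioi 0) := by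
  refine (strictAntiOn_of_deriv_neg (convex_Ioi 0) hM.contDiffOn_deriv_rev.continuousOn ?_).injOn
  simpa using hM.rev_deriv2

theorem isOpen_marginals : IsOpen M.marginals :=
  isOpen_image_of_hasStrictDerivAt isOpen_Ioi (fun _ hx => hM.hasStrictDerivAt_deriv_rev hx)
    fun x hx => (hM.rev_deriv2 x hx).ne

theorem hasDerivAt_Gam {y : ℝ} (hy : y ∈ M.marginals) :
    HasDerivAt M.Gam (deriv (deriv M.rev) (M.Gam y))⁻¹ y := by
  have := hasDerivAt_invFunOn isOpen_Ioi hM.injOn_deriv_rev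
    (fun _ hx => hM.hasStrictDerivAt_deriv_rev hx) (fun x hx => (hM.rev_deriv2 x hx).ne)
    (Gam_pos hy)
  rwa [deriv_rev_Gam hy] at this

theorem continuousOn_Gam : ContinuousOn M.Gam M.marginals := fun _ hy =>
  (hM.hasDerivAt_Gam hy).continuousAt.continuousWithinAt

/-- Envelope theorem: `χ` satisfies the first-order condition `a + θ π'(χ) - p = 0`, so only the
explicit dependence on `θ` contributes. -/
theorem Ktheta_eq {θ a : ℝ} (hθ : θ ≠ 0) (ha : a ∈ M.responseDomain θ) :
    M.Ktheta θ a = M.rev (M.chi θ a) := by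
  have hy : (M.p - a) / θ ∈ M.marginals := ha
  have h1 : HasDerivAt (fun t => (M.p - a) / t) ((M.p - a) * -(θ ^ 2)⁻¹) θ := by
    simpa [div_eq_mul_inv] using (hasDerivAt_inv hθ).const_mul (M.p - a)
  have hχ : HasDerivAt (fun t => M.chi t a) _ θ := (hM.hasDerivAt_Gam hy).comp θ h1
  have hr : HasDerivAt (fun t => M.rev (M.chi t a)) _ θ :=
    (hM.hasDerivAt_rev (Gam_pos hy)).comp θ hχ
  have hK := ((hχ.const_mul a).add ((hasDerivAt_id θ).mul hr)).sub (hχ.const_mul M.p)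
  have hfoc : θ * deriv M.rev (M.Gam ((M.p - a) / θ)) = M.p - a := by
    rw [deriv_rev_Gam hy]; field_simp
  refine HasDerivAt.deriv (hK.congr_deriv ?_)
  change _ = M.rev (M.Gam ((M.p - a) / θ))
  simp only [id, one_mul, chi]
  -- The coefficient is `∂χ/∂θ`.
  linear_combination
    ((deriv (deriv M.rev) (M.Gam ((M.p - a) / θ)))⁻¹ * ((M.p - a) * -(θ ^ 2)⁻¹)) * hfoc

/-- The factor `f` cancels the denominator in `(1 / h) f = 1 - F`. Where `f = 0` the left side is
`0` and the formula can fail. -/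
theorem Vsp_eq {θ a : ℝ} (hθ : θ ≠ 0) (hf : M.dens θ ≠ 0) (ha : a ∈ M.responseDomain θ) :
    M.Vsp θ a = (M.gain (M.chi θ a) + θ * M.rev (M.chi θ a) - M.p * M.chi θ a) * M.dens θ
      - M.rev (M.chi θ a) * (1 - M.typeCDF θ) := by
  have h1 : 1 / M.hazard θ * M.dens θ = 1 - M.typeCDF θ := by
    rw [hazard, one_div_div, div_mul_cancel₀ _ hf]
  rw [Vsp, hM.Ktheta_eq hθ ha, ← h1]
  ring

theorem isOpen_responseDomain (θ : ℝ) : IsOpen (M.responseDomain θ) :=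
  hM.isOpen_marginals.preimage (by fun_prop : Continuous fun a => (M.p - a) / θ)

/-- Chain rule through `χ`, with `θ π'(χ) - p` replaced by `-a`; the last factor of `dVsp` is
`∂χ/∂a`. -/
theorem hasDerivAt_Vsp {θ a : ℝ} (hθ : θ ≠ 0) (hf : M.dens θ ≠ 0)
    (ha : a ∈ M.responseDomain θ) : HasDerivAt (M.Vsp θ) (M.dVsp θ a) a := by
  have hy : (M.p - a) / θ ∈ M.marginals := ha
  have h1 : HasDerivAt (fun t => (M.p - t) / θ) (-1 / θ) a :=
    ((hasDerivAt_id a).const_sub M.p).div_const θ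
  have hχ : HasDerivAt (fun t => M.chi θ t) _ a := (hM.hasDerivAt_Gam hy).comp a h1
  have hr : HasDerivAt (fun t => M.rev (M.chi θ t)) _ a :=
    (hM.hasDerivAt_rev (Gam_pos hy)).comp a hχ
  have hg : HasDerivAt (fun t => M.gain (M.chi θ t)) _ a :=
    (hM.hasDerivAt_gain (Gam_pos hy)).comp a hχ
  have hV := (((hg.add (hr.const_mul θ)).sub (hχ.const_mul M.p)).mul_const (M.dens θ)).sub
    (hr.mul_const (1 - M.typeCDF θ))
  refine (hV.congr_deriv ?_).congr_of_eventuallyEq ?_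
  · rw [dVsp, chi, deriv_rev_Gam hy]
    field_simp
    ring
  · filter_upwards [(hM.isOpen_responseDomain θ).mem_nhds ha] with t ht
    exact hM.Vsp_eq hθ hf ht

/-! ### Integrability and domination along states. -/

theorem types_pos {θ : ℝ} (hθ : θ ∈ M.types) : 0 < θ := hM.lo_pos.trans_le hθ.1

theorem uIcc_eq_types : uIcc M.lo M.hi = M.types := uIcc_of_le hM.lo_lt_hi.le

theorem uIoc_subset_types : uIoc M.lo M.hi ⊆ M.types := by
  rw [uIoc_of_le hM.lo_lt_hi.le]; exact Ioc_subset_Icc_self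

theorem ae_mem_Ioo : ∀ᵐ θ, θ ∈ uIoc M.lo M.hi → θ ∈ Ioo M.lo M.hi := by
  filter_upwards [measure_eq_zero_iff_ae_notMem.1 (measure_singleton (μ := volume) M.hi)]
    with θ hne hθ
  rw [uIoc_of_le hM.lo_lt_hi.le] at hθ
  exact ⟨hθ.1, lt_of_le_of_ne hθ.2 hne⟩

theorem continuousOn_typeCDF : ContinuousOn M.typeCDF M.types := by
  rw [← hM.uIcc_eq_types]
  exact intervalIntegral.continuousOn_primitive_interval'
    (by simpa [intervalIntegrable_iff_integrableOn_Icc_of_le] using hM.dens_int) (by simp)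

/-- The standardized margin of a state is continuous. -/
theorem continuousOn_margin {a : ℝ → ℝ} (ha : ContinuousOn a M.types) :
    ContinuousOn (fun θ => (M.p - a θ) / θ) M.types :=
  (continuousOn_const.sub ha).div continuousOn_id fun _ hθ => (hM.types_pos hθ).ne'

theorem continuousOn_chi {a : ℝ → ℝ} (ha : ContinuousOn a M.types)
    (hr : ∀ θ ∈ M.types, a θ ∈ M.responseDomain θ) :
    ContinuousOn (fun θ => M.chi θ (a θ)) M.types :=
  hM.continuousOn_Gam.comp (hM.continuousOn_margin ha) fun θ hθ => hr θ hθ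

theorem intervalIntegrable_Vsp {a : ℝ → ℝ} (ha : ContinuousOn a M.types)
    (hr : ∀ θ ∈ M.types, a θ ∈ M.responseDomain θ) :
    IntervalIntegrable (fun θ => M.Vsp θ (a θ)) volume M.lo M.hi := by
  have hχ := hM.continuousOn_chi ha hr
  have hpos : MapsTo (fun θ => M.chi θ (a θ)) M.types (Ioi 0) := fun θ hθ => Gam_pos (hr θ hθ)
  have hrev := hM.rev_smooth.continuousOn.comp hχ hpos
  have hgain := hM.gain_diff.continuousOn.comp hχ hpos
  have h1 : ContinuousOn (fun θ => M.gain (M.chi θ (a θ)) + θ * M.rev (M.chi θ (a θ))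
      - M.p * M.chi θ (a θ)) (uIcc M.lo M.hi) := by
    rw [hM.uIcc_eq_types]
    exact (hgain.add (continuousOn_id.mul hrev)).sub (continuousOn_const.mul hχ)
  have h2 : ContinuousOn (fun θ => M.rev (M.chi θ (a θ)) * (1 - M.typeCDF θ))
      (uIcc M.lo M.hi) := by
    rw [hM.uIcc_eq_types]
    exact hrev.mul (continuousOn_const.sub hM.continuousOn_typeCDF)
  refine ((hM.dens_int.continuousOn_mul h1).sub h2.intervalIntegrable).congr_ae ?_
  rw [EventuallyEq, ae_restrict_iff' measurableSet_uIoc]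
  filter_upwards [hM.ae_mem_Ioo] with θ hθ hmem
  have hθ' := hM.uIoc_subset_types hmem
  exact (hM.Vsp_eq (hM.types_pos hθ').ne' (hM.dens_pos θ (hθ hmem)).ne' (hr θ hθ')).symm

/-- No continuity of `g'` is used: a derivative is always measurable. -/
theorem aestronglyMeasurable_dVsp {a : ℝ → ℝ} (ha : ContinuousOn a M.types)
    (hr : ∀ θ ∈ M.types, a θ ∈ M.responseDomain θ) :
    AEStronglyMeasurable (fun θ => M.dVsp θ (a θ)) (volume.restrict (uIoc M.lo M.hi)) := by
  have hmeas : ∀ {F : ℝ → ℝ}, ContinuousOn F M.types →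
      AEMeasurable F (volume.restrict (uIoc M.lo M.hi)) := fun hF =>
    (hF.mono hM.uIoc_subset_types).aemeasurable measurableSet_uIoc
  have hχ := hmeas (hM.continuousOn_chi ha hr)
  have hf : AEMeasurable M.dens (volume.restrict (uIoc M.lo M.hi)) :=
    hM.dens_int.def'.aestronglyMeasurable.aemeasurable
  have hg : AEMeasurable (fun θ => deriv M.gain (M.chi θ (a θ)))
      (volume.restrict (uIoc M.lo M.hi)) := (measurable_deriv M.gain).comp_aemeasurable hχ
  have hd : AEMeasurable (fun θ => deriv (deriv M.rev) (M.chi θ (a θ)))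
      (volume.restrict (uIoc M.lo M.hi)) :=
    (measurable_deriv (deriv M.rev)).comp_aemeasurable hχ
  exact ((((hg.sub (hmeas ha)).mul hf).sub ((hmeas (hM.continuousOn_margin ha)).mul
    (aemeasurable_const.sub (hmeas hM.continuousOn_typeCDF)))).mul
      (hd.inv.neg.div aemeasurable_id)).aestronglyMeasurable

/-- Concavity makes `g'` antitone, so its values at the extremes of `Γ` on `K` bound it without any
continuity of `g'`. -/
theorem exists_bound_deriv_gain_Gam {K : Set ℝ} (hK : IsCompact K) (hKm : K ⊆ M.marginals) :
    ∃ C, ∀ y ∈ K, |deriv M.gain (M.Gam y)| ≤ C := by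
  rcases K.eq_empty_or_nonempty with rfl | hne
  · exact ⟨0, by simp⟩
  obtain ⟨y₀, hy₀, hmin⟩ := hK.exists_isMinOn hne (hM.continuousOn_Gam.mono hKm)
  obtain ⟨y₁, hy₁, hmax⟩ := hK.exists_isMaxOn hne (hM.continuousOn_Gam.mono hKm)
  refine ⟨max |deriv M.gain (M.Gam y₁)| |deriv M.gain (M.Gam y₀)|, fun y hy => ?_⟩
  exact abs_le_max_abs_abs
    (hM.antitoneOn_deriv_gain (Gam_pos (hKm hy)) (Gam_pos (hKm hy₁)) (hmax hy))
    (hM.antitoneOn_deriv_gain (Gam_pos (hKm hy₀)) (Gam_pos (hKm hy)) (hmin hy))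

/-- Supplies the integrable dominating function for differentiating the objective: all factors of
`dVsp` except the density are bounded when the margin stays in `K`. -/
theorem exists_bound_dVsp {K : Set ℝ} (hK : IsCompact K) (hKm : K ⊆ M.marginals) :
    ∃ C D, ∀ θ ∈ M.types, ∀ a, (M.p - a) / θ ∈ K → |M.dVsp θ a| ≤ C * |M.dens θ| + D := by
  obtain ⟨G, hG⟩ := hM.exists_bound_deriv_gain_Gam hK hKm
  obtain ⟨Y, hY⟩ := hK.exists_bound_of_continuousOn continuousOn_id
  obtain ⟨F, hF⟩ := isCompact_Icc.exists_bound_of_continuousOn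
    (continuousOn_const.sub hM.continuousOn_typeCDF : ContinuousOn (fun θ => 1 - M.typeCDF θ) _)
  obtain ⟨R, hR⟩ := hK.exists_bound_of_continuousOn
    (((hM.continuousOn_deriv2_rev.comp hM.continuousOn_Gam fun _ => Gam_pos).inv₀
      fun y hy => (hM.rev_deriv2 _ (Gam_pos hy)).ne).mono hKm)
  refine ⟨(G + (|M.p| + M.hi * Y)) * (R / M.lo), Y * F * (R / M.lo), fun θ hθ a hy => ?_⟩
  have hθ0 := hM.types_pos hθ
  have hGy := hG _ hy
  have hYy : |(M.p - a) / θ| ≤ Y := hY _ hy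
  have hFθ : |1 - M.typeCDF θ| ≤ F := hF θ hθ
  have hRy : |(deriv (deriv M.rev) (M.Gam ((M.p - a) / θ)))⁻¹| ≤ R := hR _ hy
  have hR0 := (abs_nonneg _).trans hRy
  have hY0 := (abs_nonneg _).trans hYy
  have ha : |a| ≤ |M.p| + M.hi * Y := by
    have : a = M.p - θ * ((M.p - a) / θ) := by field_simp; ring
    rw [this]
    refine (abs_sub _ _).trans ?_
    rw [abs_mul, abs_of_pos hθ0]
    gcongr
    exacts [hM.lo_pos.le.trans hM.lo_lt_hi.le, hθ.2]
  have h1 : |-(deriv (deriv M.rev) (M.chi θ a))⁻¹ / θ| ≤ R / M.lo := by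
    rw [abs_div, abs_neg, abs_of_pos hθ0]
    exact div_le_div₀ hR0 hRy hM.lo_pos hθ.1
  have h2 : |(deriv M.gain (M.chi θ a) - a) * M.dens θ - (M.p - a) / θ * (1 - M.typeCDF θ)|
      ≤ (G + (|M.p| + M.hi * Y)) * |M.dens θ| + Y * F := by
    refine (abs_sub _ _).trans ?_
    rw [abs_mul, abs_mul]
    gcongr
    exact (abs_sub _ _).trans (add_le_add hGy ha)
  calc |M.dVsp θ a| ≤ ((G + (|M.p| + M.hi * Y)) * |M.dens θ| + Y * F) * (R / M.lo) := by
        rw [dVsp, abs_mul]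
        exact mul_le_mul h2 h1 (abs_nonneg _) ((abs_nonneg _).trans h2)
    _ = _ := by ring

/-! ### The first variation of the objective. -/

/-- Small perturbations of a state have their margins in a compact set of marginal revenues. -/
theorem exists_margin_perturbation {a η : ℝ → ℝ} (ha : ContinuousOn a M.types)
    (hr : ∀ θ ∈ M.types, a θ ∈ M.responseDomain θ) (hη : ContinuousOn η M.types) :
    ∃ K, IsCompact K ∧ K ⊆ M.marginals ∧
      ∀ᶠ ε in 𝓝 (0 : ℝ), ∀ θ ∈ M.types, (M.p - (a θ + ε * η θ)) / θ ∈ K := by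
  have hS : IsCompact ((fun θ => (M.p - a θ) / θ) '' M.types) :=
    isCompact_Icc.image_of_continuousOn (hM.continuousOn_margin ha)
  -- The margins of `a` form a compact subset of an open set, so a closed `δ`-thickening of them
  -- still fits inside.
  obtain ⟨δ, hδ, hsub⟩ := hS.exists_cthickening_subset_open hM.isOpen_marginals
    (by rintro _ ⟨θ, hθ, rfl⟩; exact hr θ hθ)
  obtain ⟨B, hB⟩ := isCompact_Icc.exists_bound_of_continuousOn
    (hη.div continuousOn_id fun _ hθ => (hM.types_pos hθ).ne')
  refine ⟨_, hS.cthickening, hsub, ?_⟩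
  have hlim : Tendsto (fun ε : ℝ => |ε| * B) (𝓝 0) (𝓝 0) := by
    have : Continuous fun ε : ℝ => |ε| * B := by fun_prop
    simpa using this.tendsto 0
  filter_upwards [hlim.eventually (eventually_le_nhds hδ)] with ε hε θ hθ
  refine Metric.mem_cthickening_of_dist_le _ ((M.p - a θ) / θ) _ _ ⟨θ, hθ, rfl⟩ ?_
  have hBθ : |η θ / θ| ≤ B := hB θ hθ
  rw [Real.dist_eq, show (M.p - (a θ + ε * η θ)) / θ - (M.p - a θ) / θ = -(ε * (η θ / θ)) by ring,
    abs_neg, abs_mul]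
  exact (mul_le_mul_of_nonneg_left hBθ (abs_nonneg ε)).trans hε

theorem eventually_mem_responseDomain {a η : ℝ → ℝ} (ha : ContinuousOn a M.types)
    (hr : ∀ θ ∈ M.types, a θ ∈ M.responseDomain θ) (hη : ContinuousOn η M.types) :
    ∀ᶠ ε in 𝓝 (0 : ℝ), ∀ θ ∈ M.types, a θ + ε * η θ ∈ M.responseDomain θ := by
  obtain ⟨K, -, hKm, hK⟩ := hM.exists_margin_perturbation ha hr hη
  exact hK.mono fun ε hε θ hθ => hKm (hε θ hθ)

/-- The first variation of the objective. -/
theorem hasDerivAt_objective {a η : ℝ → ℝ} (ha : ContinuousOn a M.types)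
    (hr : ∀ θ ∈ M.types, a θ ∈ M.responseDomain θ) (hη : ContinuousOn η M.types) :
    IntervalIntegrable (fun θ => M.dVsp θ (a θ) * η θ) volume M.lo M.hi ∧
      HasDerivAt (fun ε => M.objective fun θ => a θ + ε * η θ)
        (∫ θ in M.lo..M.hi, M.dVsp θ (a θ) * η θ) 0 := by
  obtain ⟨K, hKc, hKm, hK⟩ := hM.exists_margin_perturbation ha hr hη
  obtain ⟨C, D, hCD⟩ := hM.exists_bound_dVsp hKc hKm
  obtain ⟨B, hB⟩ := isCompact_Icc.exists_bound_of_continuousOn hη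
  have hae : ∀ ε : ℝ, ContinuousOn (fun θ => a θ + ε * η θ) M.types := fun ε =>
    ha.add (continuousOn_const.mul hη)
  have hmeas := (hM.aestronglyMeasurable_dVsp ha hr).mul
    ((hη.mono hM.uIoc_subset_types).aestronglyMeasurable measurableSet_uIoc)
  have key := intervalIntegral.hasDerivAt_integral_of_dominated_loc_of_deriv_le
    (μ := volume) (a := M.lo) (b := M.hi)
    (F := fun ε θ => M.Vsp θ (a θ + ε * η θ))
    (F' := fun ε θ => M.dVsp θ (a θ + ε * η θ) * η θ) (x₀ := (0 : ℝ))
    (bound := fun θ => (C * |M.dens θ| + D) * B) hK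
    (hK.mono fun ε hε =>
      (hM.intervalIntegrable_Vsp (hae ε) fun θ hθ => hKm (hε θ hθ)).def'.aestronglyMeasurable)
    (by simpa using hM.intervalIntegrable_Vsp ha hr)
    (by simp only [zero_mul, add_zero]; exact hmeas)
    (ae_of_all _ fun θ hθ ε hε => by
      have hθ' := hM.uIoc_subset_types hθ
      rw [Real.norm_eq_abs, abs_mul]
      have h1 := hCD θ hθ' _ (hε θ hθ')
      exact mul_le_mul h1 (hB θ hθ') (abs_nonneg _) ((abs_nonneg _).trans h1))
    (((hM.dens_int.abs.const_mul C).add intervalIntegrable_const).mul_const B)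
    (by
      filter_upwards [hM.ae_mem_Ioo] with θ hθ hmem ε hε
      have hθ' := hM.uIoc_subset_types hmem
      have h1 : HasDerivAt (fun ε => a θ + ε * η θ) (η θ) ε := by
        simpa using ((hasDerivAt_id ε).mul_const (η θ)).const_add (a θ)
      exact (hM.hasDerivAt_Vsp (hM.types_pos hθ').ne' (hM.dens_pos θ (hθ hmem)).ne'
        (hKm (hε θ hθ'))).comp ε h1)
  simp only [zero_mul, add_zero] at key
  exact key

theorem intervalIntegrable_dVsp {a : ℝ → ℝ} (ha : ContinuousOn a M.types)
    (hr : ∀ θ ∈ M.types, a θ ∈ M.responseDomain θ) :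
    IntervalIntegrable (fun θ => M.dVsp θ (a θ)) volume M.lo M.hi := by
  -- The direction `1` breaks the initial condition, but the first variation does not require it.
  simpa using (hM.hasDerivAt_objective ha hr (η := fun _ => 1) continuousOn_const).1

end Regular
end TaskModel

/-! ### The costate and the minimum principle. -/

/-- Integration by parts against a function vanishing at the right end. -/
theorem AbsolutelyContinuousOnInterval.integral_mul_eq_neg_of_ae_hasDerivAt
    {F G F' G' : ℝ → ℝ} {a b : ℝ} (hF : AbsolutelyContinuousOnInterval F a b)
    (hG : AbsolutelyContinuousOnInterval G a b) (hFb : F b = 0) (hGa : G a = 0)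
    (hF' : ∀ᵐ x, x ∈ uIoc a b → HasDerivAt F (F' x) x)
    (hG' : ∀ᵐ x, x ∈ uIoc a b → HasDerivAt G (G' x) x) :
    ∫ x in a..b, F' x * G x = -∫ x in a..b, F x * G' x := by
  have h := hF.integral_mul_deriv_eq_deriv_mul hG
  rw [hFb, hGa, intervalIntegral.integral_congr_ae (g := fun x => F x * G' x),
    intervalIntegral.integral_congr_ae (g := fun x => F' x * G x) (f := fun x => deriv F x * G x)]
    at h
  · linarith
  · filter_upwards [hF'] with x hx hmem
    rw [(hx hmem).deriv]
  · filter_upwards [hG'] with x hx hmem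
    rw [(hx hmem).deriv]

/-- The derivative at a point from which the function does not increase to the right is
nonpositive. -/
theorem HasDerivAt.nonpos_of_eventually_le {F : ℝ → ℝ} {d x : ℝ} (hd : HasDerivAt F d x)
    (h : ∀ᶠ y in 𝓝[>] x, F y ≤ F x) : d ≤ 0 := by
  have hlim := (hasDerivWithinAt_iff_tendsto_slope' self_notMem_Ioi).1
    (hd.hasDerivWithinAt (s := Ioi x))
  refine le_of_tendsto hlim ?_
  filter_upwards [h, self_mem_nhdsWithin] with y hy hxy
  rw [slope_def_field]
  exact div_nonpos_of_nonpos_of_nonneg (by linarith) (sub_nonneg.2 (le_of_lt hxy))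

namespace TaskModel

variable {M : TaskModel}

theorem ae_restrict_types_iff {P : ℝ → Prop} :
    (∀ᵐ θ ∂volume.restrict M.types, P θ) ↔ ∀ᵐ θ, θ ∈ M.types → P θ :=
  ae_restrict_iff' measurableSet_Icc

theorem ae_types_mem_Ioo : ∀ᵐ θ ∂volume.restrict M.types, θ ∈ Ioo M.lo M.hi := by
  rw [types, ← restrict_Ioo_eq_restrict_Icc]
  exact ae_restrict_mem measurableSet_Ioo

theorem deriv_Ham_costate (θ a u l : ℝ) : deriv (fun l => M.Ham θ a u l) l = u :=
  (((hasDerivAt_id l).mul_const u).const_add (M.Vsp θ a)).deriv.trans (one_mul u)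

/-- The costate: minus the marginal value of raising the reward factor from `θ` on. -/
def costate (M : TaskModel) (α : ℝ → ℝ) (θ : ℝ) : ℝ :=
  ∫ t in M.hi..θ, M.dVsp t (α t)

namespace Regular

variable (hM : M.Regular)
include hM

theorem ae_uIoc_of_ae_types {P : ℝ → Prop} (h : ∀ᵐ θ ∂volume.restrict M.types, P θ) :
    ∀ᵐ θ, θ ∈ uIoc M.lo M.hi → P θ :=
  (ae_restrict_types_iff.1 h).mono fun _ hθ hmem => hθ (hM.uIoc_subset_types hmem)

theorem deriv_Ham_state {θ a : ℝ} (u l : ℝ) (hθ : θ ∈ Ioo M.lo M.hi)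
    (ha : a ∈ M.responseDomain θ) : deriv (fun a => M.Ham θ a u l) a = M.dVsp θ a :=
  ((hM.hasDerivAt_Vsp (hM.lo_pos.trans hθ.1).ne' (hM.dens_pos θ hθ).ne' ha).add_const
    (l * u)).deriv

theorem continuousOn_of_absolutelyContinuous {a : ℝ → ℝ}
    (ha : AbsolutelyContinuousOnInterval a M.lo M.hi) : ContinuousOn a M.types := by
  rw [← hM.uIcc_eq_types]
  exact ha.continuousOn

/-- Feasible states stay between the states generated by the extreme controls. -/
theorem mem_reachable {u α : ℝ → ℝ} (h : M.IsFeasible u α) {θ : ℝ} (hθ : θ ∈ M.types) :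
    α θ ∈ M.reachable θ := by
  have hsub : uIcc M.lo θ ⊆ uIcc M.lo M.hi := by
    rw [uIcc_of_le hθ.1, uIcc_of_le hM.lo_lt_hi.le]
    exact Icc_subset_Icc_right hθ.2
  have hac := h.state.abs_cont.mono hsub
  have hbd : ∀ᵐ t ∂volume.restrict (Icc M.lo θ), 0 ≤ deriv α t ∧ deriv α t ≤ M.ubar := by
    refine ae_restrict_of_ae_restrict_of_subset (Icc_subset_Icc_right hθ.2) ?_
    filter_upwards [h.dynamics, h.control] with t hd hc
    rwa [hd.deriv]
  have hint := hac.integral_deriv_eq_sub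
  rw [h.state.initial] at hint
  have h0 : 0 ≤ ∫ t in M.lo..θ, deriv α t :=
    intervalIntegral.integral_nonneg_of_ae_restrict hθ.1 (hbd.mono fun _ ht => ht.1)
  have h1 : ∫ t in M.lo..θ, deriv α t ≤ ∫ _ in M.lo..θ, M.ubar :=
    intervalIntegral.integral_mono_ae_restrict hθ.1 hac.intervalIntegrable_deriv
      intervalIntegrable_const (hbd.mono fun _ ht => ht.2)
  rw [intervalIntegral.integral_const, smul_eq_mul] at h1
  exact ⟨h.state.response θ hθ, by linarith, by linarith⟩

theorem absolutelyContinuous_costate {α : ℝ → ℝ} (hα : M.IsState α) :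
    AbsolutelyContinuousOnInterval (M.costate α) M.lo M.hi :=
  (hM.intervalIntegrable_dVsp (hM.continuousOn_of_absolutelyContinuous hα.abs_cont)
    hα.response).absolutelyContinuousOnInterval_intervalIntegral right_mem_uIcc

theorem ae_hasDerivAt_costate {α : ℝ → ℝ} (hα : M.IsState α) :
    ∀ᵐ θ ∂volume.restrict M.types, HasDerivAt (M.costate α) (M.dVsp θ (α θ)) θ := by
  rw [ae_restrict_types_iff, ← hM.uIcc_eq_types]
  filter_upwards [(hM.intervalIntegrable_dVsp (hM.continuousOn_of_absolutelyContinuous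
    hα.abs_cont) hα.response).ae_hasDerivAt_integral] with θ hθ hmem
  exact hθ hmem M.hi right_mem_uIcc

/-- Optimality tested against moving the control towards another admissible control. -/
theorem integral_costate_nonneg {u α v : ℝ → ℝ} (h : M.IsOptimal u α)
    (hv : IntervalIntegrable v volume M.lo M.hi) (hvU : ∀ θ, v θ ∈ M.controls) :
    0 ≤ ∫ θ in M.lo..M.hi, M.costate α θ * (v θ - u θ) := by
  have hα := h.1.state
  -- The state driven by `v`, minus `α`. The former may leave the response domain; only `α + ε η`
  -- for small `ε` must stay in it.
  let η : ℝ → ℝ := fun θ => (M.a₀ + ∫ t in M.lo..θ, v t) - α θ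
  have hηac : AbsolutelyContinuousOnInterval η M.lo M.hi := by
    refine AbsolutelyContinuousOnInterval.fun_sub (.fun_add ?_
      (hv.absolutelyContinuousOnInterval_intervalIntegral left_mem_uIcc)) hα.abs_cont
    exact (contDiff_const.contDiffOn).absolutelyContinuousOnInterval
  have hη0 : η M.lo = 0 := by simp [η, hα.initial]
  have hηd : ∀ᵐ θ ∂volume.restrict M.types, HasDerivAt η (v θ - u θ) θ := by
    have hvd := hv.ae_hasDerivAt_integral
    rw [hM.uIcc_eq_types, ← ae_restrict_types_iff] at hvd
    filter_upwards [hvd, h.1.dynamics] with θ h1 h2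
    exact ((h1 M.lo (left_mem_Icc.2 hM.lo_lt_hi.le)).const_add M.a₀).sub h2
  have hαc := hM.continuousOn_of_absolutelyContinuous hα.abs_cont
  have hηc := hM.continuousOn_of_absolutelyContinuous hηac
  have hnonpos : ∫ θ in M.lo..M.hi, M.dVsp θ (α θ) * η θ ≤ 0 := by
    refine (hM.hasDerivAt_objective hαc hα.response hηc).2.nonpos_of_eventually_le ?_
    filter_upwards [nhdsWithin_le_nhds (hM.eventually_mem_responseDomain hαc hα.response hηc),
      Ioc_mem_nhdsGT zero_lt_one] with ε hε hε01
    simp only [zero_mul, add_zero]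
    refine h.2 (fun θ => u θ + ε * (v θ - u θ)) _
      ⟨⟨hα.abs_cont.fun_add (hηac.const_mul ε), by simp [hη0, hα.initial], hε⟩, ?_, ?_⟩
    · filter_upwards [h.1.dynamics, hηd] with θ h1 h2
      exact h1.add (h2.const_mul ε)
    · filter_upwards [h.1.control] with θ h1
      have := (convex_Icc 0 M.ubar) h1 (hvU θ) (sub_nonneg.2 hε01.2) hε01.1.le (by ring)
      simp only [smul_eq_mul] at this
      rwa [show (1 - ε) * u θ + ε * v θ = u θ + ε * (v θ - u θ) by ring] at this
  rw [(hM.absolutelyContinuous_costate hα).integral_mul_eq_neg_of_ae_hasDerivAt hηac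
    intervalIntegral.integral_same hη0 (hM.ae_uIoc_of_ae_types (hM.ae_hasDerivAt_costate hα))
    (hM.ae_uIoc_of_ae_types hηd)] at hnonpos
  linarith

/-- Optimality against the bang-bang control that minimizes the Hamiltonian. -/
theorem ae_isMinOn_costate_mul {u α : ℝ → ℝ} (hubar : 0 ≤ M.ubar) (h : M.IsOptimal u α) :
    ∀ᵐ θ ∂volume.restrict M.types, IsMinOn (fun w => M.costate α θ * w) M.controls (u θ) := by
  have hα := h.1.state
  have hlam := hM.absolutelyContinuous_costate hα
  have hlamc := hM.continuousOn_of_absolutelyContinuous hlam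
  -- A continuous extension of the costate to the line, so that the switching control `v` is
  -- measurable everywhere.
  let L : ℝ → ℝ := IccExtend hM.lo_lt_hi.le (M.types.domRestrict (M.costate α))
  have hL : Continuous L := (continuousOn_iff_continuous_domRestrict.1 hlamc).Icc_extend'
  have hLeq : ∀ θ ∈ M.types, L θ = M.costate α θ := fun θ hθ => IccExtend_of_mem _ _ hθ
  let v : ℝ → ℝ := fun θ => if 0 ≤ L θ then 0 else M.ubar
  have hvU : ∀ θ, v θ ∈ M.controls := fun θ => by
    simp only [v]
    split_ifs
    · exact left_mem_Icc.2 hubar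
    · exact right_mem_Icc.2 hubar
  have hvm : Measurable v :=
    Measurable.ite (measurableSet_le measurable_const hL.measurable) measurable_const
      measurable_const
  have hv : IntervalIntegrable v volume M.lo M.hi :=
    (intervalIntegrable_const (c := M.ubar)).mono_fun' hvm.aestronglyMeasurable
      (ae_of_all _ fun θ =>
        (abs_of_nonneg (hvU θ).1).trans_le (hvU θ).2)
  have hvmin : ∀ θ ∈ M.types, ∀ w ∈ M.controls, M.costate α θ * v θ ≤ M.costate α θ * w := by
    intro θ hθ w hw
    simp only [v, hLeq θ hθ]
    split_ifs with hs
    · rw [mul_zero]; exact mul_nonneg hs hw.1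
    · exact mul_le_mul_of_nonpos_left hw.2 (not_le.1 hs).le
  -- Nothing is assumed on `u` itself; it inherits integrability from `deriv α`.
  have hu : IntervalIntegrable u volume M.lo M.hi := by
    refine hα.abs_cont.intervalIntegrable_deriv.congr_ae ?_
    rw [EventuallyEq, ae_restrict_iff' measurableSet_uIoc]
    filter_upwards [hM.ae_uIoc_of_ae_types h.1.dynamics] with θ hθ hmem
    exact (hθ hmem).deriv
  have hint : IntervalIntegrable (fun θ => M.costate α θ * (u θ - v θ)) volume M.lo M.hi :=
    (hu.sub hv).continuousOn_mul hlam.continuousOn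
  have hle : ∀ᵐ θ ∂volume.restrict (Ioc M.lo M.hi), 0 ≤ M.costate α θ * (u θ - v θ) := by
    rw [ae_restrict_iff' measurableSet_Ioc]
    filter_upwards [ae_restrict_types_iff.1 h.1.control] with θ hθ hmem
    have hmem' := Ioc_subset_Icc_self hmem
    have := hvmin θ hmem' _ (hθ hmem')
    linarith
  -- The integrand is nonnegative because `v` minimizes pointwise, while optimality makes the
  -- integral nonpositive; so `u` attains the minimum almost everywhere.
  have hzero : ∫ θ in M.lo..M.hi, M.costate α θ * (u θ - v θ) = 0 := by
    refine le_antisymm ?_ (intervalIntegral.integral_nonneg_of_ae_restrict hM.lo_lt_hi.le ?_)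
    · have := hM.integral_costate_nonneg h hv hvU
      rw [← neg_nonneg, ← intervalIntegral.integral_neg]
      simpa only [← mul_neg, neg_sub] using this
    · rwa [restrict_Ioc_eq_restrict_Icc] at hle
  rw [intervalIntegral.integral_eq_zero_iff_of_le_of_nonneg_ae hM.lo_lt_hi.le hle hint] at hzero
  rw [EventuallyEq, restrict_Ioc_eq_restrict_Icc] at hzero
  filter_upwards [hzero, ae_restrict_mem measurableSet_Icc] with θ h0 hmem w hw
  have := hvmin θ hmem w hw
  simp only [Pi.zero_apply] at h0
  change M.costate α θ * u θ ≤ M.costate α θ * w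
  linarith

theorem minimumPrinciple_of_isOptimal {u α : ℝ → ℝ} (hubar : 0 ≤ M.ubar)
    (h : M.IsOptimal u α) : M.MinimumPrinciple u α (M.costate α) where
  costate_abs_cont := hM.absolutelyContinuous_costate h.1.state
  state_eq := by simpa only [deriv_Ham_costate] using h.1.dynamics
  costate_eq := by
    filter_upwards [hM.ae_hasDerivAt_costate h.1.state, ae_types_mem_Ioo (M := M)] with θ hθ hmem
    rwa [hM.deriv_Ham_state _ _ hmem (h.1.state.response θ (Ioo_subset_Icc_self hmem))]
  argmin := by
    filter_upwards [hM.ae_isMinOn_costate_mul hubar h, h.1.control] with θ hmin hc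
    exact ⟨hc, fun w hw => add_le_add_right (hmin hw) (M.Vsp θ (α θ))⟩
  terminal := intervalIntegral.integral_same

/-- Tangent-line inequality at `α`, then integration by parts against the costate; the boundary
terms vanish by `lam hi = 0` and the common initial value of the states. -/
theorem isOptimal_of_minimumPrinciple {u α lam : ℝ → ℝ} (hα : M.IsState α)
    (hconc : ∀ θ ∈ M.types, ConcaveOn ℝ (M.reachable θ) (M.Vsp θ))
    (h : M.MinimumPrinciple u α lam) : M.IsOptimal u α := by
  have hfeas : M.IsFeasible u α :=
    ⟨hα, by simpa only [deriv_Ham_costate] using h.state_eq, h.argmin.mono fun _ hθ => hθ.1⟩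
  refine ⟨hfeas, fun v β hβ => ?_⟩
  have hαc := hM.continuousOn_of_absolutelyContinuous hα.abs_cont
  have hβc := hM.continuousOn_of_absolutelyContinuous hβ.state.abs_cont
  have hηac := hβ.state.abs_cont.fun_sub hα.abs_cont
  have hlamd : ∀ᵐ θ ∂volume.restrict M.types, HasDerivAt lam (M.dVsp θ (α θ)) θ := by
    filter_upwards [h.costate_eq, ae_types_mem_Ioo (M := M)] with θ hθ hmem
    rwa [hM.deriv_Ham_state _ _ hmem (hα.response θ (Ioo_subset_Icc_self hmem))] at hθ
  have hηd : ∀ᵐ θ ∂volume.restrict M.types, HasDerivAt (fun θ => β θ - α θ) (v θ - u θ) θ := by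
    filter_upwards [hβ.dynamics, hfeas.dynamics] with θ h1 h2
    exact h1.sub h2
  have hparts := h.costate_abs_cont.integral_mul_eq_neg_of_ae_hasDerivAt hηac h.terminal
    (by simp [hα.initial, hβ.state.initial]) (hM.ae_uIoc_of_ae_types hlamd)
    (hM.ae_uIoc_of_ae_types hηd)
  have hnonneg : 0 ≤ ∫ θ in M.lo..M.hi, lam θ * (v θ - u θ) := by
    refine intervalIntegral.integral_nonneg_of_ae_restrict hM.lo_lt_hi.le ?_
    filter_upwards [h.argmin, hβ.control] with θ h1 h2
    have : M.Vsp θ (α θ) + lam θ * u θ ≤ M.Vsp θ (α θ) + lam θ * v θ := h1.2 h2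
    simp only [Pi.zero_apply]
    linarith
  have hVα := hM.intervalIntegrable_Vsp hαc hα.response
  have hVβ := hM.intervalIntegrable_Vsp hβc hβ.state.response
  have hmono : ∫ θ in M.lo..M.hi, (M.Vsp θ (β θ) - M.Vsp θ (α θ)) ≤
      ∫ θ in M.lo..M.hi, M.dVsp θ (α θ) * (β θ - α θ) := by
    refine intervalIntegral.integral_mono_ae_restrict hM.lo_lt_hi.le (hVβ.sub hVα)
      (hM.hasDerivAt_objective hαc hα.response (hβc.sub hαc)).1 ?_
    filter_upwards [ae_types_mem_Ioo (M := M)] with θ hmem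
    have hθ := Ioo_subset_Icc_self hmem
    -- Concavity is available only on reachable values, so both states must be shown to lie there.
    exact (hconc θ hθ).sub_le_mul_sub_of_hasDerivAt (hM.mem_reachable hfeas hθ)
      (hM.mem_reachable hβ hθ) (hM.hasDerivAt_Vsp (hM.types_pos hθ).ne' (hM.dens_pos θ hmem).ne'
        (hα.response θ hθ))
  rw [intervalIntegral.integral_sub hVβ hVα, hparts] at hmono
  change (∫ θ in M.lo..M.hi, M.Vsp θ (β θ)) ≤ ∫ θ in M.lo..M.hi, M.Vsp θ (α θ)
  linarith

end Regular
end TaskModel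

end

theorem proposition4 (M : TaskModel)
    (hlo : 0 < M.lo) (hlohi : M.lo < M.hi) (hp : 0 < M.p) (hubar : 0 < M.ubar)
    -- `π` and `g` are non-decreasing and strictly concave on `(0, ∞)`, and smooth enough for
    -- `Γ` and `V_sp` to be continuously differentiable in the reward factor
    (hrev_mono : MonotoneOn M.rev (Ioi 0)) (hrev_conc : StrictConcaveOn ℝ (Ioi 0) M.rev)
    (hrev_smooth : ContDiffOn ℝ 2 M.rev (Ioi 0))
    (hrev_deriv2 : ∀ x ∈ Ioi (0 : ℝ), deriv (deriv M.rev) x < 0)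
    (hgain_mono : MonotoneOn M.gain (Ioi 0)) (hgain_conc : StrictConcaveOn ℝ (Ioi 0) M.gain)
    (hgain_diff : DifferentiableOn ℝ M.gain (Ioi 0))
    -- `f` is a probability density on `Θ`, positive inside `Θ`, with increasing hazard rate
    (hdens_int : IntervalIntegrable M.dens volume M.lo M.hi)
    (hdens_pos : ∀ θ ∈ Ioo M.lo M.hi, 0 < M.dens θ)
    (hdens_one : ∫ θ in M.lo..M.hi, M.dens θ = 1)
    (hhazard : MonotoneOn M.hazard (Ico M.lo M.hi))
    (u α : ℝ → ℝ) (hα : M.IsState α) :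
    -- the minimum principle is necessary for optimality, ...
    (M.IsOptimal u α → ∃ lam : ℝ → ℝ, M.MinimumPrinciple u α lam) ∧
    -- ... and, `V_sp` being concave in the reward factor, necessary and sufficient
    ((∀ θ ∈ M.types, ConcaveOn ℝ (M.reachable θ) (M.Vsp θ)) →
      (M.IsOptimal u α ↔ ∃ lam : ℝ → ℝ, M.MinimumPrinciple u α lam)) := by
  have hM : M.Regular := ⟨hlo, hlohi, hrev_smooth, hrev_deriv2, hgain_conc.concaveOn, hgain_diff,
    hdens_int, hdens_pos⟩
  have hnec : M.IsOptimal u α → ∃ lam : ℝ → ℝ, M.MinimumPrinciple u α lam := fun h =>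
    ⟨_, hM.minimumPrinciple_of_isOptimal hubar.le h⟩
  exact ⟨hnec, fun hconc => ⟨hnec, fun ⟨_, h⟩ => hM.isOptimal_of_minimumPrinciple hα hconc h⟩⟩
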